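/- **Setting.** Let $1\le m\le d$ be integers. A *semi-bandit problem* consists of a non-empty set $\mathcal A$ of actions, each action being a set of exactly $m$ of the $d$ arms, and of a probability law on $\mathbb R^d$ with mean $\mu$. The reward vectors $X_1,X_2,\dots$ are i.i.d. with this law. At each stage $t\ge 1$ an algorithm, which knows $\mathcal A$, chooses $A_t\in\mathcal A$ as a measurable function of the past actions, of the past observations $(X_s^{(i)})_{i\in A_s}$, $s<t$, and possibly of an internal random seed independent of the rewards. The gap of $A\in\mathcal A$ is $\Delta_A=\max_{B\in\mathcal A}\sum_{i\in B}\mu^{(i)}-\sum_{i\in A}\mu^{(i)}$, and the expected regret is $\mathbb E R_T=\mathbb E\sum_{t=1}^T\Delta_{A_t}$. For $\sigma>0$ and $\gamma\in[0,1]$, the problem is said to have *$\sigma$-subgaussian arms and correlation coefficients at most $\gamma$* if there is a positive semi-definite matrix $C$ with $\mathbb E\, e^{u^\top(X_1-\mu)}\le e^{\frac12u^\top Cu}$ for all $u\in\mathbb R^d$, with $C^{(ii)}\le\sigma^2$ for all $i$, and with $C^{(ij)}/\sqrt{C^{(ii)}C^{(jj)}}\le\gamma$ for all $i\ne j$ (where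 $0/0=0$). An algorithm is *consistent* if, on every problem with $\sigma$-subgaussian arms and correlation coefficients at most $\gamma$, $\mathbb E R_t=o(t^a)$ as $t\to+\infty$ for all $a>0$. **Theorem 1 (lower bound).** Suppose that $d$ is a multiple of $m$, and let $\sigma>0$ and $\gamma\in[0,1]$. Then for any $\Delta>0$ and any consistent algorithm, there is a semi-bandit problem with $\sigma$-subgaussian arms and correlation coefficients at most $\gamma$, all of whose gaps are $\Delta$ (that is, $\Delta_A\in\{0,\Delta\}$ for every $A\in\mathcal A$), on which $$\liminf_{t\to+\infty}\frac{\mathbb E R_t}{\log t}\;\ge\;(1+\gamma(m-1))\,\frac{2\sigma^2(d-m)}{\Delta}.$$ -/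

import Mathlib

open MeasureTheory Filter Matrix

namespace SemiBandit

/-- A non-empty family of admissible actions, each a set of exactly `m` arms among `d`. -/
structure ActionSet (d m : ℕ) where
  actions : Finset (Finset (Fin d))
  nonempty : actions.Nonempty
  card_eq : ∀ A ∈ actions, A.card = m

/-- A stochastic semi-bandit problem: the admissible actions, and the common law of the
i.i.d. reward vectors of the `d` arms. -/
structure Problem (d m : ℕ) where
  actionSet : ActionSet d m
  law : Measure (Fin d → ℝ)
  isProb : IsProbabilityMeasure law

/-- What is recorded at one stage: the action played and the reward vector restricted to the
arms of that action (the other coordinates are replaced by `0`). -/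
abbrev Observation (d : ℕ) : Type := Finset (Fin d) × (Fin d → ℝ)

/-- The semi-bandit feedback for action `A` when the reward vector is `x`. -/
def observe {d : ℕ} (A : Finset (Fin d)) (x : Fin d → ℝ) : Observation d :=
  (A, fun i => if i ∈ A then x i else 0)

/-- A (possibly randomized) algorithm for problems with `d` arms and actions of size `m`. It is
told the admissible actions. Its internal randomization is a seed in `S`, drawn once and
independently of the rewards. After `t` stages it chooses the next action as a measurable
function of the seed and of the observations of these `t` stages. -/
structure Algorithm (d m : ℕ) (S : Type*) [MeasurableSpace S] where
  seedLaw : Measure S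
  isProb : IsProbabilityMeasure seedLaw
  act : ActionSet d m → (t : ℕ) → S × (Fin t → Observation d) → Finset (Fin d)
  measurable_act : ∀ (𝒜 : ActionSet d m) (t : ℕ), Measurable (act 𝒜 t)
  act_mem : ∀ (𝒜 : ActionSet d m) (t : ℕ) (h : S × (Fin t → Observation d)),
    act 𝒜 t h ∈ 𝒜.actions

section Problem

variable {d m : ℕ}

/-- The mean reward of each arm. -/
noncomputable def Problem.mean (p : Problem d m) : Fin d → ℝ :=
  fun i => ∫ x, x i ∂p.law

/-- The mean reward of an action. -/
noncomputable def Problem.value (p : Problem d m) (A : Finset (Fin d)) : ℝ :=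
  ∑ i ∈ A, p.mean i

/-- The gap of an action: the mean reward of a best admissible action minus that of `A`. -/
noncomputable def Problem.gap (p : Problem d m) (A : Finset (Fin d)) : ℝ :=
  p.actionSet.actions.sup' p.actionSet.nonempty p.value - p.value A

/-- `C` is a subgaussian covariance matrix of the noise `X - μ`: it is positive semi-definite
and `E exp (uᵀ (X - μ)) ≤ exp (uᵀ C u / 2)` for all `u`. -/
def Problem.IsSubgaussianCov (p : Problem d m) (C : Matrix (Fin d) (Fin d) ℝ) : Prop :=
  C.PosSemidef ∧ ∀ u : Fin d → ℝ,
    Integrable (fun x : Fin d → ℝ => Real.exp (u ⬝ᵥ (x - p.mean))) p.law ∧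
    ∫ x, Real.exp (u ⬝ᵥ (x - p.mean)) ∂p.law ≤ Real.exp ((u ⬝ᵥ (C *ᵥ u)) / 2)

/-- The problem has `σ`-subgaussian arms and correlation coefficients at most `γ`: there is a
subgaussian covariance matrix with diagonal at most `σ ^ 2` and all of whose off-diagonal
correlation coefficients are at most `γ`. -/
def Problem.IsSubgaussianWith (p : Problem d m) (σ γ : ℝ) : Prop :=
  ∃ C : Matrix (Fin d) (Fin d) ℝ, p.IsSubgaussianCov C ∧
    (∀ i, C i i ≤ σ ^ 2) ∧
    ∀ i j, i ≠ j → C i j / Real.sqrt (C i i * C j j) ≤ γ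

end Problem

section Run

variable {d m : ℕ} {S : Type*} [MeasurableSpace S]

/-- The observations of the first `t` stages when the algorithm faces the admissible actions `𝒜`,
has seed `ω.1`, and the successive reward vectors are `ω.2 0, ω.2 1, …`. -/
def Algorithm.history (π : Algorithm d m S) (𝒜 : ActionSet d m)
    (ω : S × (ℕ → Fin d → ℝ)) : (t : ℕ) → Fin t → Observation d
  | 0 => Fin.elim0
  | t + 1 => Fin.snoc (α := fun _ => Observation d) (π.history 𝒜 ω t)
      (observe (π.act 𝒜 t (ω.1, π.history 𝒜 ω t)) (ω.2 t))

/-- The action played after `t` stages, that is, at the stage numbered `t + 1`. -/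
def Algorithm.action (π : Algorithm d m S) (𝒜 : ActionSet d m) (t : ℕ)
    (ω : S × (ℕ → Fin d → ℝ)) : Finset (Fin d) :=
  π.act 𝒜 t (ω.1, π.history 𝒜 ω t)

/-- The joint law of the seed and of the i.i.d. reward vectors. -/
noncomputable def jointLaw (π : Algorithm d m S) (p : Problem d m) :
    Measure (S × (ℕ → Fin d → ℝ)) :=
  haveI := p.isProb
  π.seedLaw.prod (Measure.infinitePi fun _ : ℕ => p.law)

/-- The expected regret after `T` stages. -/
noncomputable def expectedRegret (π : Algorithm d m S) (p : Problem d m) (T : ℕ) : ℝ :=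
  ∫ ω, ∑ t ∈ Finset.range T, p.gap (π.action p.actionSet t ω) ∂(jointLaw π p)

/-- The algorithm is consistent for `σ`-subgaussian arms with correlation coefficients at most
`γ`: on every such problem its expected regret is `o(t ^ a)` for all `a > 0`. -/
def Algorithm.IsConsistent (π : Algorithm d m S) (σ γ : ℝ) : Prop :=
  ∀ p : Problem d m, p.IsSubgaussianWith σ γ → ∀ a : ℝ, 0 < a →
    (fun t : ℕ => expectedRegret π p t) =o[atTop] (fun t : ℕ => (t : ℝ) ^ a)

end Run

end SemiBandit

open ProbabilityTheory InformationTheory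
open scoped ENNReal Topology

/-!
Partition the arms into `d / m` blocks of `m` arms, let the blocks be the actions, and let the
rewards be Gaussian with variance `σ²`, correlation `γ` inside each block and independent blocks,
the arms of one block having mean `Δ / m` and all others mean `0`. Vectors that are constant on the
blocks are eigenvectors of the covariance matrix for the eigenvalue `σ² (1 + γ (m - 1))`.

Raise by `r Δ / m`, where `r > 1`, the means of a suboptimal block `b`: it becomes the only optimal
action, the feedback changes only when `b` is played, and each such play contributes at most
`(r Δ)² / (2 m σ² (1 + γ (m - 1)))` to the Kullback–Leibler divergence between the laws of the
histories. A consistent algorithm plays `b` only `o(T^a)` times on the first problem, but all but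
`o(T^a)` times on the second. By the Bretagnolle–Huber inequality, telling the two problems apart
so well requires a divergence of at least `(1 - o(1)) log T`. Hence the expected number of plays of
`b` is at least `(1 - o(1)) log T` times `2 m σ² (1 + γ (m - 1)) / (r Δ)²`; each of them costs `Δ`,
and there are `d / m - 1` such blocks.
-/

section Divergence

variable {α β : Type*} [MeasurableSpace α] [MeasurableSpace β]

lemma memLp_two_sqrt {μ : Measure α} {f : α → ℝ} (hf : 0 ≤ f) (hint : Integrable f μ) :
    MemLp (fun x => √(f x)) 2 μ := by
  refine (memLp_two_iff_integrable_sq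
    (Real.continuous_sqrt.comp_aestronglyMeasurable hint.aestronglyMeasurable)).2 ?_
  simpa only [Real.sq_sqrt (hf _)] using hint

lemma integral_sqrt_le (μ : Measure α) [IsFiniteMeasure μ] {f : α → ℝ} (hf : 0 ≤ f)
    (hint : Integrable f μ) : ∫ x, √(f x) ∂μ ≤ √(∫ x, f x ∂μ) * √(μ.real Set.univ) := by
  have h := integral_mul_le_Lp_mul_Lq_of_nonneg Real.HolderConjugate.two_two
    (ae_of_all μ fun x => Real.sqrt_nonneg (f x)) (ae_of_all μ fun _ => zero_le_one)
    (by simpa using memLp_two_sqrt hf hint) (memLp_const 1)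
  simpa only [Real.rpow_two, Real.sq_sqrt (hf _), one_pow, mul_one, ← Real.sqrt_eq_rpow,
    integral_const, smul_eq_mul] using h

lemma klDiv_tilted_right (μ : Measure α) [IsProbabilityMeasure μ] {f : α → ℝ}
    (hf : Integrable f μ) (hexp : Integrable (fun x => Real.exp (f x)) μ) :
    klDiv μ (μ.tilted f) =
      ENNReal.ofReal (Real.log (∫ x, Real.exp (f x) ∂μ) - ∫ x, f x ∂μ) := by
  have := isProbabilityMeasure_tilted hexp
  have hself : llr μ μ =ᵐ[μ] 0 := llr_self μ
  have hint : Integrable (llr μ μ) μ := (integrable_zero _ _ _).congr hself.symm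
  rw [klDiv_of_ac_of_integrable (absolutelyContinuous_tilted hexp)
      (integrable_llr_tilted_right .rfl hf hint hexp),
    integral_llr_tilted_right .rfl hf hexp hint, integral_congr_ae hself]
  simp only [Pi.zero_apply, integral_zero, probReal_univ]
  ring_nf

-- The Bretagnolle–Huber inequality: Jensen's inequality gives `exp (-KL / 2) ≤ ∫ √(dν/dμ) dμ`, and
-- the Cauchy–Schwarz inequality bounds this integral on `s` and on its complement.
lemma exp_neg_half_klDiv_le (μ ν : Measure α) [IsProbabilityMeasure μ] [IsProbabilityMeasure ν]
    (h : klDiv μ ν ≠ ∞) {s : Set α} (hs : MeasurableSet s) :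
    Real.exp (-(klDiv μ ν).toReal / 2) ≤ √(ν.real s) + √(μ.real sᶜ) := by
  obtain ⟨hac, hllr⟩ := klDiv_ne_top_iff.1 h
  set r : α → ℝ := fun x => (ν.rnDeriv μ x).toReal
  have hr : Integrable r μ := Measure.integrable_toReal_rnDeriv
  have hexp : (fun x => Real.exp (-llr μ ν x / 2)) =ᵐ[μ] fun x => √(r x) := by
    filter_upwards [exp_neg_llr hac] with x hx
    rw [Real.sqrt_eq_rpow, show r x = Real.exp (-llr μ ν x) from hx.symm, ← Real.exp_mul]
    ring_nf
  have hsqrt : Integrable (fun x => √(r x)) μ :=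
    (memLp_two_sqrt (fun x => ENNReal.toReal_nonneg) hr).integrable one_le_two
  have hCS (t : Set α) : ∫ x in t, √(r x) ∂μ ≤ √(ν.real t) * √(μ.real t) := by
    refine (integral_sqrt_le _ (fun x => ENNReal.toReal_nonneg) hr.integrableOn).trans ?_
    rw [measureReal_restrict_apply_univ]
    gcongr
    exact Measure.setIntegral_toReal_rnDeriv_le (measure_ne_top ν t)
  calc Real.exp (-(klDiv μ ν).toReal / 2)
      = Real.exp (∫ x, -llr μ ν x / 2 ∂μ) := by
        rw [toReal_klDiv_of_measure_eq hac (by simp), integral_div, integral_neg]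
    _ ≤ ∫ x, Real.exp (-llr μ ν x / 2) ∂μ :=
        convexOn_exp.map_integral_le Real.continuous_exp.continuousOn isClosed_univ (by simp)
          (hllr.neg.div_const 2) (hsqrt.congr hexp.symm)
    _ = ∫ x in s, √(r x) ∂μ + ∫ x in sᶜ, √(r x) ∂μ := by
        rw [integral_congr_ae hexp, integral_add_compl hs hsqrt]
    _ ≤ √(ν.real s) * √(μ.real s) + √(ν.real sᶜ) * √(μ.real sᶜ) := add_le_add (hCS s) (hCS sᶜ)
    _ ≤ √(ν.real s) + √(μ.real sᶜ) := by
        gcongr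
        · exact mul_le_of_le_one_right (by positivity) (by simp)
        · exact mul_le_of_le_one_left (by positivity) (by simp)

variable [MeasurableSpace.CountableOrCountablyGenerated α β]

lemma klDiv_kernel_eq_lintegral (κ η : Kernel α β) [IsFiniteKernel κ] [IsFiniteKernel η]
    {a : α} (hac : κ a ≪ η a) :
    klDiv (κ a) (η a) = ∫⁻ b, ENNReal.ofReal (klFun (κ.rnDeriv η a b).toReal) ∂η a := by
  rw [klDiv_eq_lintegral_klFun_of_ac hac]
  refine lintegral_congr_ae ?_
  filter_upwards [Kernel.rnDeriv_eq_rnDeriv_measure (κ := κ) (η := η) (a := a)] with b hb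
  rw [hb]

lemma measurable_klDiv (κ η : Kernel α β) [IsFiniteKernel κ] [IsFiniteKernel η] :
    Measurable fun a => klDiv (κ a) (η a) := by
  classical
  have h (a : α) : klDiv (κ a) (η a) = if κ a ≪ η a then
      ∫⁻ b, ENNReal.ofReal (klFun (κ.rnDeriv η a b).toReal) ∂η a else ∞ := by
    split_ifs with hac
    · exact klDiv_kernel_eq_lintegral κ η hac
    · exact klDiv_of_not_ac hac
  simp_rw [h]
  have := Kernel.measurable_rnDeriv κ η
  exact Measurable.ite (Kernel.measurableSet_absolutelyContinuous κ η)
    (Measurable.lintegral_kernel_prod_right (by fun_prop)) measurable_const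

lemma rnDeriv_compProd_right {μ : Measure α} [IsFiniteMeasure μ] {κ η : Kernel α β}
    [IsFiniteKernel κ] [IsFiniteKernel η] (hac : ∀ᵐ a ∂μ, κ a ≪ η a) :
    (μ ⊗ₘ κ).rnDeriv (μ ⊗ₘ η) =ᵐ[μ ⊗ₘ η] fun p => κ.rnDeriv η p.1 p.2 := by
  have hκ : κ =ᵐ[μ] η.withDensity (κ.rnDeriv η) := by
    filter_upwards [hac] with a ha using (Kernel.withDensity_rnDeriv_eq ha).symm
  rw [Measure.compProd_congr hκ, Measure.compProd_withDensity (Kernel.measurable_rnDeriv κ η)]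
  exact Measure.rnDeriv_withDensity _ (Kernel.measurable_rnDeriv κ η)

lemma klDiv_compProd_right (μ : Measure α) [IsFiniteMeasure μ] (κ η : Kernel α β)
    [IsFiniteKernel κ] [IsFiniteKernel η] :
    klDiv (μ ⊗ₘ κ) (μ ⊗ₘ η) = ∫⁻ a, klDiv (κ a) (η a) ∂μ := by
  by_cases hac : ∀ᵐ a ∂μ, κ a ≪ η a
  · have := Kernel.measurable_rnDeriv κ η
    calc klDiv (μ ⊗ₘ κ) (μ ⊗ₘ η)
        = ∫⁻ p, ENNReal.ofReal (klFun (κ.rnDeriv η p.1 p.2).toReal) ∂(μ ⊗ₘ η) := by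
          rw [klDiv_eq_lintegral_klFun_of_ac
            (Measure.absolutelyContinuous_compProd_right_iff.2 hac)]
          refine lintegral_congr_ae ?_
          filter_upwards [rnDeriv_compProd_right hac] with p hp
          rw [hp]
      _ = ∫⁻ a, ∫⁻ b, ENNReal.ofReal (klFun (κ.rnDeriv η a b).toReal) ∂η a ∂μ :=
          Measure.lintegral_compProd (by fun_prop)
      _ = ∫⁻ a, klDiv (κ a) (η a) ∂μ := by
          refine lintegral_congr_ae ?_
          filter_upwards [hac] with a ha using (klDiv_kernel_eq_lintegral κ η ha).symm
  · rw [klDiv_of_not_ac (mt Measure.absolutelyContinuous_compProd_right_iff.1 hac)]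
    by_contra hne
    refine hac ?_
    filter_upwards [ae_lt_top (measurable_klDiv κ η) (Ne.symm hne)] with a ha
    exact (klDiv_ne_top_iff.1 ha.ne).1

end Divergence

section Gaussian

variable {E : Type*} [NormedAddCommGroup E] [NormedSpace ℝ E] [MeasurableSpace E]

lemma mgf_dual_gaussian (μ : Measure E) [IsGaussian μ] (L : StrongDual ℝ E) (t : ℝ) :
    mgf L μ t = Real.exp (μ[L] * t + Var[L; μ] * t ^ 2 / 2) := by
  rw [mgf_gaussianReal (IsGaussian.map_eq_gaussianReal L),
    Real.coe_toNNReal _ (variance_nonneg _ _)]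

lemma integrableExpSet_dual_gaussian (μ : Measure E) [IsGaussian μ] (L : StrongDual ℝ E) :
    integrableExpSet L μ = Set.univ := by
  refine Set.eq_univ_of_forall fun t => ?_
  refine mgf_pos_iff.1 ?_
  rw [mgf_dual_gaussian]
  positivity

lemma integral_exp_dual_gaussian (μ : Measure E) [IsGaussian μ] (L : StrongDual ℝ E) :
    ∫ x, Real.exp (L x) ∂μ = Real.exp (μ[L] + Var[L; μ] / 2) := by
  simpa [mgf] using mgf_dual_gaussian μ L 1

lemma integrable_exp_dual_gaussian (μ : Measure E) [IsGaussian μ] (L : StrongDual ℝ E) :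
    Integrable (fun x => Real.exp (L x)) μ := by
  have h : (1 : ℝ) ∈ integrableExpSet L μ := integrableExpSet_dual_gaussian μ L ▸ Set.mem_univ 1
  simpa [integrableExpSet] using h

variable [BorelSpace E] [CompleteSpace E] [SecondCountableTopology E]

lemma ext_of_mgf_dual {μ ν : Measure E} [IsProbabilityMeasure μ] [IsProbabilityMeasure ν]
    (hμ : ∀ L : StrongDual ℝ E, 0 ∈ interior (integrableExpSet L μ))
    (h : ∀ L : StrongDual ℝ E, mgf L μ = mgf L ν) : μ = ν := by
  refine Measure.ext_of_charFunDual (funext fun L => ?_)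
  have h1 := eqOn_complexMGF_of_mgf (h L) (x := Complex.I) (by simpa using hμ L)
  simpa only [complexMGF, charFunDual_apply, mul_comm] using h1

-- The Cameron–Martin shift formula; the two measures have the same moment generating function along
-- every continuous linear form.
lemma gaussian_tilted_eq_map_add (μ : Measure E) [IsGaussian μ] (L : StrongDual ℝ E) {v : E}
    (hv : ∀ K : StrongDual ℝ E, K v = cov[K, L; μ]) :
    μ.tilted L = μ.map (· + v) := by
  have hL : Integrable (fun x => Real.exp (L x)) μ := integrable_exp_dual_gaussian μ L
  have := isProbabilityMeasure_tilted hL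
  refine (ext_of_mgf_dual (fun K => ?_) fun K => funext fun t => ?_).symm
  · simp [integrableExpSet_dual_gaussian]
  have hvar : Var[⇑(L + t • K); μ] = Var[L; μ] + 2 * (t * K v) + t ^ 2 * Var[K; μ] := by
    rw [FunLike.coe_add, FunLike.coe_smul, variance_add, covariance_smul_right, covariance_comm,
      variance_smul, hv]
    · exact IsGaussian.memLp_dual μ L 2 (by simp)
    · exact IsGaussian.memLp_dual μ (t • K) 2 (by simp)
  have hmean : ∫ x, (L + t • K) x ∂μ = μ[L] + t * μ[K] := by
    simp only [_root_.add_apply, _root_.smul_apply, smul_eq_mul]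
    rw [integral_add (IsGaussian.integrable_dual μ L)
      ((IsGaussian.integrable_dual μ K).const_mul t), integral_const_mul]
  calc mgf K (μ.map (· + v)) t
      = Real.exp (K v * t) * Real.exp (μ[K] * t + Var[K; μ] * t ^ 2 / 2) := by
        rw [← mgf_dual_gaussian, mgf_map (by fun_prop) (by fun_prop)]
        simp only [mgf, Function.comp_def, map_add, mul_add, Real.exp_add, integral_mul_const]
        ring_nf
    _ = (∫ x, Real.exp ((L + t • K) x) ∂μ) / ∫ x, Real.exp (L x) ∂μ := by
        rw [integral_exp_dual_gaussian, integral_exp_dual_gaussian, ← Real.exp_sub, ← Real.exp_add,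
          hvar, hmean]
        ring_nf
    _ = mgf K (μ.tilted L) t := (integral_exp_tilted (μ := μ) L (t • K)).symm

lemma klDiv_gaussian_map_add (μ : Measure E) [IsGaussian μ] (L : StrongDual ℝ E) {v : E}
    (hv : ∀ K : StrongDual ℝ E, K v = cov[K, L; μ]) :
    klDiv μ (μ.map (· + v)) = ENNReal.ofReal (Var[L; μ] / 2) := by
  rw [← gaussian_tilted_eq_map_add μ L hv, klDiv_tilted_right μ (IsGaussian.integrable_dual μ L)
    (integrable_exp_dual_gaussian μ L), integral_exp_dual_gaussian, Real.log_exp,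
    add_sub_cancel_left]

end Gaussian

section GaussianPi

variable {ι : Type*} [Fintype ι]

/-- The linear form `x ↦ u ⬝ᵥ x` as an element of the dual, through which the results on Gaussian
measures on normed spaces apply to `ι → ℝ`. -/
noncomputable def dotProductDual (u : ι → ℝ) : StrongDual ℝ (ι → ℝ) :=
  ∑ i, u i • ContinuousLinearMap.proj i

lemma dotProductDual_apply (u x : ι → ℝ) : dotProductDual u x = u ⬝ᵥ x := by
  simp [dotProductDual, dotProduct]

lemma dotProductDual_surjective : Function.Surjective (dotProductDual (ι := ι)) := by
  classical
  intro K
  refine ⟨fun i => K (Pi.single i 1), ContinuousLinearMap.ext fun x => ?_⟩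
  rw [dotProductDual_apply, dotProduct]
  conv_rhs => rw [pi_eq_sum_univ' x, map_sum]
  simp [mul_comm]

variable [DecidableEq ι]

/-- The Gaussian measure of mean `μ` and covariance matrix `C` on `ι → ℝ`, the type of the reward
vectors; it carries Mathlib's `multivariateGaussian` over from `EuclideanSpace ℝ ι`. It has
covariance `C` only if `C` is positive semi-definite. -/
noncomputable def gaussianPi (μ : ι → ℝ) (C : Matrix ι ι ℝ) : Measure (ι → ℝ) :=
  (multivariateGaussian (WithLp.toLp 2 μ) C).map (EuclideanSpace.equiv ι ℝ)

instance isGaussian_gaussianPi (μ : ι → ℝ) (C : Matrix ι ι ℝ) : IsGaussian (gaussianPi μ C) := by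
  unfold gaussianPi; infer_instance

lemma integral_id_gaussianPi (μ : ι → ℝ) (C : Matrix ι ι ℝ) :
    ∫ x, x ∂gaussianPi μ C = μ := by
  rw [gaussianPi, integral_map (by fun_prop) (by fun_prop),
    (EuclideanSpace.equiv ι ℝ).integral_comp_comm, integral_id_multivariateGaussian]
  rfl

lemma integral_dotProductDual_gaussianPi (μ : ι → ℝ) (C : Matrix ι ι ℝ) (u : ι → ℝ) :
    ∫ x, dotProductDual u x ∂gaussianPi μ C = u ⬝ᵥ μ := by
  rw [ContinuousLinearMap.integral_comp_id_comm IsGaussian.integrable_id,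
    dotProductDual_apply, integral_id_gaussianPi]

lemma covariance_dotProductDual_gaussianPi (μ : ι → ℝ) {C : Matrix ι ι ℝ} (hC : C.PosSemidef)
    (u v : ι → ℝ) :
    cov[dotProductDual u, dotProductDual v; gaussianPi μ C] = u ⬝ᵥ C *ᵥ v := by
  have hinner (w : ι → ℝ) : dotProductDual w ∘ EuclideanSpace.equiv ι ℝ =
      fun x => inner ℝ (WithLp.toLp 2 w) x := by
    ext x
    exact (dotProductDual_apply w _).trans (dotProduct_comm _ _)
  rw [gaussianPi, covariance_map (by fun_prop) (by fun_prop) (by fun_prop), hinner, hinner,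
    ← covarianceBilin_apply_eq_cov (IsGaussian.memLp_two_id),
    covarianceBilin_multivariateGaussian hC]

lemma map_add_gaussianPi (μ v : ι → ℝ) (C : Matrix ι ι ℝ) :
    (gaussianPi μ C).map (· + v) = gaussianPi (μ + v) C := by
  simp only [gaussianPi, multivariateGaussian]
  rw [Measure.map_map (by fun_prop) (by fun_prop), Measure.map_map (by fun_prop) (by fun_prop),
    Measure.map_map (by fun_prop) (by fun_prop)]
  congr 1
  ext x i
  simp [add_right_comm]

lemma klDiv_gaussianPi (μ w : ι → ℝ) {C : Matrix ι ι ℝ} (hC : C.PosSemidef) :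
    klDiv (gaussianPi μ C) (gaussianPi (μ + C *ᵥ w) C) = ENNReal.ofReal (w ⬝ᵥ C *ᵥ w / 2) := by
  rw [← map_add_gaussianPi, klDiv_gaussian_map_add _ (dotProductDual w),
    ← covariance_self (by fun_prop), covariance_dotProductDual_gaussianPi μ hC]
  intro K
  obtain ⟨u, rfl⟩ := dotProductDual_surjective K
  rw [covariance_dotProductDual_gaussianPi μ hC, dotProductDual_apply]

lemma integrable_exp_dotProduct_gaussianPi (μ u : ι → ℝ) (C : Matrix ι ι ℝ) :
    Integrable (fun x => Real.exp (u ⬝ᵥ (x - μ))) (gaussianPi μ C) := by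
  simp only [dotProduct_sub, Real.exp_sub, ← dotProductDual_apply]
  exact (integrable_exp_dual_gaussian _ _).div_const _

lemma integral_exp_dotProduct_gaussianPi (μ u : ι → ℝ) {C : Matrix ι ι ℝ} (hC : C.PosSemidef) :
    ∫ x, Real.exp (u ⬝ᵥ (x - μ)) ∂gaussianPi μ C = Real.exp (u ⬝ᵥ C *ᵥ u / 2) := by
  simp only [dotProduct_sub, Real.exp_sub, ← dotProductDual_apply, integral_div]
  rw [integral_exp_dual_gaussian, integral_dotProductDual_gaussianPi,
    ← covariance_self (by fun_prop), covariance_dotProductDual_gaussianPi μ hC,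
    dotProductDual_apply, dotProductDual_apply, Real.exp_add,
    mul_div_cancel_left₀ _ (Real.exp_ne_zero _)]

end GaussianPi

section Product

lemma measurePreserving_update_infinitePi {ι : Type*} [DecidableEq ι] {X : ι → Type*}
    [∀ i, MeasurableSpace (X i)] (μ : ∀ i, Measure (X i)) [∀ i, IsProbabilityMeasure (μ i)]
    (j : ι) :
    MeasurePreserving (fun q : (∀ i, X i) × X j => Function.update q.1 j q.2)
      ((Measure.infinitePi μ).prod (μ j)) (Measure.infinitePi μ) := by
  have hmeas : Measurable fun q : (∀ i, X i) × X j => Function.update q.1 j q.2 :=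
    measurable_update'
  refine ⟨hmeas, Measure.eq_infinitePi _ fun s t ht => ?_⟩
  have hpre : (fun q : (∀ i, X i) × X j => Function.update q.1 j q.2) ⁻¹' (s : Set ι).pi t =
      ((s.erase j : Finset ι) : Set ι).pi t ×ˢ (if j ∈ s then t j else Set.univ) := by
    ext ⟨x, y⟩
    by_cases hj : j ∈ s <;>
      simp +contextual only [Set.mem_preimage, Set.mem_prod, Finset.coe_erase,
        Set.update_mem_pi_iff, Finset.mem_coe, hj, forall_const, reduceIte, Set.mem_univ,
        false_imp_iff, and_true]
  rw [Measure.map_apply hmeas (MeasurableSet.pi s.countable_toSet fun i _ => ht i), hpre,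
    Measure.prod_prod, Measure.infinitePi_pi _ fun i _ => ht i]
  split_ifs with hj
  · exact Finset.prod_erase_mul s (fun i => μ i (t i)) hj
  · simp [Finset.erase_eq_of_notMem hj]

@[fun_prop]
lemma measurable_snoc {Ω E : Type*} [MeasurableSpace Ω] [MeasurableSpace E] {t : ℕ}
    {h : Ω → Fin t → E} {e : Ω → E} (hh : Measurable h) (he : Measurable e) :
    Measurable fun ω => (Fin.snoc (α := fun _ => E) (h ω) (e ω) : Fin (t + 1) → E) := by
  refine measurable_pi_iff.2 fun i => ?_
  refine Fin.lastCases ?_ (fun s => ?_) i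
  · simpa using he
  · simpa using measurable_pi_iff.1 hh s

end Product

namespace SemiBandit

section Interaction

variable {d m : ℕ} {S : Type*} [MeasurableSpace S]

instance (p : Problem d m) : IsProbabilityMeasure p.law := p.isProb

instance (π : Algorithm d m S) : IsProbabilityMeasure π.seedLaw := π.isProb

instance (π : Algorithm d m S) (p : Problem d m) : IsProbabilityMeasure (jointLaw π p) := by
  unfold jointLaw; infer_instance

@[fun_prop]
lemma measurable_observe {Ω : Type*} [MeasurableSpace Ω] {A : Ω → Finset (Fin d)}
    {x : Ω → Fin d → ℝ} (hA : Measurable A) (hx : Measurable x) :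
    Measurable fun ω => observe (A ω) (x ω) := by
  refine hA.prodMk (measurable_pi_iff.2 fun i => ?_)
  exact Measurable.ite (hA (MeasurableSet.of_discrete (s := {A | i ∈ A})))
    (measurable_pi_iff.1 hx i) measurable_const

@[fun_prop]
lemma measurable_history (π : Algorithm d m S) (𝒜 : ActionSet d m) (t : ℕ) :
    Measurable fun ω => π.history 𝒜 ω t := by
  induction t with
  | zero => exact measurable_const
  | succ t ih =>
    exact measurable_snoc ih (measurable_observe
      ((π.measurable_act 𝒜 t).comp (measurable_fst.prodMk ih)) (by fun_prop))

@[fun_prop]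
lemma measurable_action (π : Algorithm d m S) (𝒜 : ActionSet d m) (t : ℕ) :
    Measurable (π.action 𝒜 t) :=
  (π.measurable_act 𝒜 t).comp (measurable_fst.prodMk (measurable_history π 𝒜 t))

lemma history_congr (π : Algorithm d m S) (𝒜 : ActionSet d m) {s : S} {x y : ℕ → Fin d → ℝ}
    {t : ℕ} (h : ∀ r < t, x r = y r) : π.history 𝒜 (s, x) t = π.history 𝒜 (s, y) t := by
  induction t with
  | zero => rfl
  | succ t ih =>
    simp only [Algorithm.history, ih fun r hr => h r (hr.trans t.lt_succ_self), h t t.lt_succ_self]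

lemma history_fst (π : Algorithm d m S) (𝒜 : ActionSet d m) (ω : S × (ℕ → Fin d → ℝ)) {t : ℕ}
    (s : Fin t) : (π.history 𝒜 ω t s).1 = π.action 𝒜 s ω := by
  induction t with
  | zero => exact s.elim0
  | succ t ih =>
    refine Fin.lastCases ?_ (fun s => ?_) s
    · simp [Algorithm.history, observe, Algorithm.action]
    · simpa [Algorithm.history] using ih s

/-- The law of the seed together with the observations of the first `t` stages. -/
noncomputable def historyLaw (π : Algorithm d m S) (p : Problem d m) (t : ℕ) :
    Measure (S × (Fin t → Observation d)) :=
  (jointLaw π p).map fun ω => (ω.1, π.history p.actionSet ω t)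

instance (π : Algorithm d m S) (p : Problem d m) (t : ℕ) :
    IsProbabilityMeasure (historyLaw π p t) :=
  Measure.isProbabilityMeasure_map (by fun_prop)

/-- The law of the observation made at one stage, as a kernel from the action played. -/
noncomputable def Problem.feedback (p : Problem d m) :
    Kernel (Finset (Fin d)) (Observation d) :=
  Kernel.ofFunOfCountable fun A => p.law.map (observe A)

lemma Problem.feedback_apply (p : Problem d m) (A : Finset (Fin d)) :
    p.feedback A = p.law.map (observe A) := rfl

instance (p : Problem d m) : IsMarkovKernel p.feedback :=
  ⟨fun _ => Measure.isProbabilityMeasure_map (by fun_prop)⟩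

/-- The law of the next observation after `t` stages, as a kernel from the seed and the
observations of these stages. -/
noncomputable def nextObservation (π : Algorithm d m S) (p : Problem d m) (t : ℕ) :
    Kernel (S × (Fin t → Observation d)) (Observation d) :=
  p.feedback.comap (π.act p.actionSet t) (π.measurable_act _ _)

instance (π : Algorithm d m S) (p : Problem d m) (t : ℕ) :
    IsMarkovKernel (nextObservation π p t) := by
  unfold nextObservation; infer_instance

lemma historyLaw_zero (π : Algorithm d m S) (p : Problem d m) :
    historyLaw π p 0 = π.seedLaw.map fun s => (s, Fin.elim0) := by
  rw [← (measurePreserving_fst (μ := π.seedLaw)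
    (ν := Measure.infinitePi fun _ : ℕ => p.law)).map_eq,
    Measure.map_map (by fun_prop) (by fun_prop)]
  rfl

lemma measurePreserving_resample (π : Algorithm d m S) (p : Problem d m) (t : ℕ) :
    MeasurePreserving
      (fun q : (S × (ℕ → Fin d → ℝ)) × (Fin d → ℝ) => (q.1.1, Function.update q.1.2 t q.2))
      ((jointLaw π p).prod p.law) (jointLaw π p) :=
  ((MeasurePreserving.id π.seedLaw).prod
    (measurePreserving_update_infinitePi (fun _ => p.law) t)).comp
      (measurePreserving_prodAssoc π.seedLaw (Measure.infinitePi fun _ : ℕ => p.law) p.law)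

-- The reward vector of the next stage may be resampled without affecting the history.
lemma map_jointLaw_history_observe (π : Algorithm d m S) (p : Problem d m) (t : ℕ) :
    (jointLaw π p).map (fun ω => ((ω.1, π.history p.actionSet ω t),
      observe (π.action p.actionSet t ω) (ω.2 t))) =
    historyLaw π p t ⊗ₘ nextObservation π p t := by
  have hhist (ω : S × (ℕ → Fin d → ℝ)) (x : Fin d → ℝ) :
      π.history p.actionSet (ω.1, Function.update ω.2 t x) t = π.history p.actionSet ω t :=
    history_congr π p.actionSet fun r hr => Function.update_of_ne hr.ne _ _
  refine Measure.ext_of_lintegral _ fun f hf => ?_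
  have hmeas : Measurable fun ω => f ((ω.1, π.history p.actionSet ω t),
      observe (π.action p.actionSet t ω) (ω.2 t)) := by fun_prop
  have hresample := measurePreserving_resample π p t
  rw [lintegral_map hf (by fun_prop), ← hresample.lintegral_comp hmeas,
    lintegral_prod _ (by exact (hmeas.comp hresample.measurable).aemeasurable),
    Measure.lintegral_compProd hf, historyLaw,
    lintegral_map hf.lintegral_kernel_prod_right' (by fun_prop)]
  refine lintegral_congr fun ω => ?_
  rw [nextObservation, Kernel.comap_apply, Problem.feedback_apply,
    lintegral_map (by fun_prop) (by fun_prop)]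
  simp only [Algorithm.action, hhist, Function.update_self]

lemma historyLaw_succ (π : Algorithm d m S) (p : Problem d m) (t : ℕ) :
    historyLaw π p (t + 1) = (historyLaw π p t ⊗ₘ nextObservation π p t).map
      fun q => (q.1.1, Fin.snoc (α := fun _ => Observation d) q.1.2 q.2) := by
  rw [← map_jointLaw_history_observe, Measure.map_map (by fun_prop) (by fun_prop)]
  rfl

lemma klDiv_historyLaw_le (π : Algorithm d m S) {p p' : Problem d m}
    (hp : p'.actionSet = p.actionSet) (T : ℕ) :
    klDiv (historyLaw π p T) (historyLaw π p' T) ≤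
      ∑ t ∈ Finset.range T, ∫⁻ ω, klDiv (p.feedback (π.action p.actionSet t ω))
        (p'.feedback (π.action p.actionSet t ω)) ∂jointLaw π p := by
  induction T with
  | zero => simp [historyLaw_zero]
  | succ T ih =>
    have hnext : ∫⁻ h, klDiv (nextObservation π p T h) (nextObservation π p' T h)
        ∂historyLaw π p T = ∫⁻ ω, klDiv (p.feedback (π.action p.actionSet T ω))
          (p'.feedback (π.action p.actionSet T ω)) ∂jointLaw π p := by
      rw [historyLaw, lintegral_map (measurable_klDiv _ _) (by fun_prop)]
      simp only [nextObservation, hp, Kernel.comap_apply, Algorithm.action]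
    calc klDiv (historyLaw π p (T + 1)) (historyLaw π p' (T + 1))
        ≤ klDiv (historyLaw π p T ⊗ₘ nextObservation π p T)
            (historyLaw π p' T ⊗ₘ nextObservation π p' T) := by
          rw [historyLaw_succ, historyLaw_succ]
          exact klDiv_map_le _ _ (by fun_prop)
      _ = klDiv (historyLaw π p T) (historyLaw π p' T) +
            ∫⁻ h, klDiv (nextObservation π p T h) (nextObservation π p' T h)
              ∂historyLaw π p T := by
          rw [klDiv_compProd_eq_add, klDiv_compProd_right]
      _ ≤ _ := by
          rw [Finset.sum_range_succ, hnext]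
          gcongr

end Interaction

section Regret

variable {d m : ℕ} {S : Type*} [MeasurableSpace S] (π : Algorithm d m S) (p : Problem d m)

/-- The expected number of times the action `A` is played during the first `T` stages. -/
noncomputable def expectedPulls (A : Finset (Fin d)) (T : ℕ) : ℝ :=
  ∑ t ∈ Finset.range T, (jointLaw π p).real {ω | π.action p.actionSet t ω = A}

lemma expectedPulls_nonneg (A : Finset (Fin d)) (T : ℕ) : 0 ≤ expectedPulls π p A T :=
  Finset.sum_nonneg fun _ _ => measureReal_nonneg

lemma integral_comp_action (f : Finset (Fin d) → ℝ) (t : ℕ) :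
    ∫ ω, f (π.action p.actionSet t ω) ∂jointLaw π p =
      ∑ A ∈ p.actionSet.actions,
        f A * (jointLaw π p).real {ω | π.action p.actionSet t ω = A} := by
  have hmeas := measurable_action π p.actionSet t
  have := Measure.isProbabilityMeasure_map (μ := jointLaw π p) hmeas.aemeasurable
  rw [← integral_map (μ := jointLaw π p) (f := f) hmeas.aemeasurable
    (measurable_of_finite f).aestronglyMeasurable, integral_fintype .of_finite,
    ← Finset.sum_subset (Finset.subset_univ p.actionSet.actions)]
  · refine Finset.sum_congr rfl fun A _ => ?_
    rw [map_measureReal_apply hmeas (measurableSet_singleton A), smul_eq_mul, mul_comm]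
    rfl
  · intro A _ hA
    have hempty : π.action p.actionSet t ⁻¹' {A} = ∅ :=
      Set.eq_empty_of_forall_notMem fun ω hω => hA (hω ▸ π.act_mem _ _ _)
    rw [map_measureReal_apply hmeas (measurableSet_singleton A), hempty, measureReal_empty,
      zero_smul]

lemma expectedRegret_eq_sum (T : ℕ) :
    expectedRegret π p T = ∑ A ∈ p.actionSet.actions, p.gap A * expectedPulls π p A T := by
  have hint (t : ℕ) : Integrable (fun ω => p.gap (π.action p.actionSet t ω)) (jointLaw π p) :=
    (Integrable.of_finite (μ := (jointLaw π p).map (π.action p.actionSet t))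
      (f := p.gap)).comp_measurable (measurable_action π p.actionSet t)
  rw [expectedRegret, integral_finsetSum _ fun t _ => hint t]
  simp only [integral_comp_action, expectedPulls, Finset.mul_sum]
  exact Finset.sum_comm

lemma sum_expectedPulls (T : ℕ) :
    ∑ A ∈ p.actionSet.actions, expectedPulls π p A T = T := by
  have h (t : ℕ) := integral_comp_action π p (fun _ => 1) t
  simp only [integral_const, probReal_univ, smul_eq_mul, one_mul] at h
  simp only [expectedPulls]
  rw [Finset.sum_comm]
  simp [← h]

lemma Problem.gap_nonneg {A : Finset (Fin d)} (hA : A ∈ p.actionSet.actions) : 0 ≤ p.gap A :=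
  sub_nonneg.2 (Finset.le_sup' p.value hA)

lemma gap_mul_expectedPulls_le {A : Finset (Fin d)} (hA : A ∈ p.actionSet.actions) (T : ℕ) :
    p.gap A * expectedPulls π p A T ≤ expectedRegret π p T := by
  rw [expectedRegret_eq_sum]
  exact Finset.single_le_sum (f := fun A => p.gap A * expectedPulls π p A T)
    (fun B hB => mul_nonneg (p.gap_nonneg hB) (expectedPulls_nonneg π p B T)) hA

variable {π p}

lemma Algorithm.IsConsistent.expectedPulls_isLittleO {σ γ : ℝ} (hπ : π.IsConsistent σ γ)
    (hp : p.IsSubgaussianWith σ γ) {A : Finset (Fin d)} (hA : A ∈ p.actionSet.actions)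
    (hgap : 0 < p.gap A) {a : ℝ} (ha : 0 < a) :
    expectedPulls π p A =o[atTop] fun t : ℕ => (t : ℝ) ^ a := by
  refine Asymptotics.IsBigO.trans_isLittleO (.of_bound (p.gap A)⁻¹ (.of_forall fun T => ?_))
    (hπ p hp a ha)
  rw [Real.norm_of_nonneg (expectedPulls_nonneg π p A T), inv_mul_eq_div, le_div_iff₀' hgap]
  exact (gap_mul_expectedPulls_le π p hA T).trans (le_abs_self _)

lemma Algorithm.IsConsistent.sub_expectedPulls_isLittleO {σ γ : ℝ} (hπ : π.IsConsistent σ γ)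
    (hp : p.IsSubgaussianWith σ γ) {b : Finset (Fin d)} (hb : b ∈ p.actionSet.actions)
    (hgap : ∀ A ∈ p.actionSet.actions, A ≠ b → 0 < p.gap A) {a : ℝ} (ha : 0 < a) :
    (fun T : ℕ => T - expectedPulls π p b T) =o[atTop] fun t : ℕ => (t : ℝ) ^ a := by
  have hsum (T : ℕ) : T - expectedPulls π p b T =
      ∑ A ∈ p.actionSet.actions.erase b, expectedPulls π p A T := by
    rw [← sum_expectedPulls π p T, ← Finset.add_sum_erase _ _ hb, add_sub_cancel_left]
  simp only [hsum]
  refine Asymptotics.IsLittleO.fun_sum fun A hA => ?_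
  obtain ⟨hAb, hA⟩ := Finset.mem_erase.1 hA
  exact hπ.expectedPulls_isLittleO hp hA (hgap A hA hAb) ha

end Regret

section PullCount

variable {d T : ℕ}

/-- The number of times the action `A` is played in a history of `T` stages. -/
noncomputable def pullCount (A : Finset (Fin d)) (h : Fin T → Observation d) : ℝ :=
  ∑ s, if (h s).1 = A then 1 else 0

lemma pullCount_nonneg (A : Finset (Fin d)) (h : Fin T → Observation d) : 0 ≤ pullCount A h :=
  Finset.sum_nonneg fun _ _ => by split_ifs <;> simp

lemma pullCount_le (A : Finset (Fin d)) (h : Fin T → Observation d) : pullCount A h ≤ T := by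
  refine (Finset.sum_le_sum (g := fun _ => (1 : ℝ)) fun s _ => ?_).trans_eq (by simp)
  split_ifs <;> simp

@[fun_prop]
lemma measurable_pullCount (A : Finset (Fin d)) :
    Measurable (pullCount A : (Fin T → Observation d) → ℝ) :=
  Finset.measurable_sum _ fun s _ => Measurable.ite
    (measurable_fst.comp (measurable_pi_apply s) (measurableSet_singleton A))
    measurable_const measurable_const

end PullCount

section ChangeOfMeasure

variable {d m : ℕ} {S : Type*} [MeasurableSpace S] (π : Algorithm d m S) {p p' : Problem d m}

lemma klDiv_historyLaw_le_mul_expectedPulls (hp : p'.actionSet = p.actionSet)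
    {b : Finset (Fin d)} (h : ∀ A ∈ p.actionSet.actions, A ≠ b → p.feedback A = p'.feedback A)
    (T : ℕ) :
    klDiv (historyLaw π p T) (historyLaw π p' T) ≤
      klDiv (p.feedback b) (p'.feedback b) * ENNReal.ofReal (expectedPulls π p b T) := by
  have hact (t : ℕ) (ω : S × (ℕ → Fin d → ℝ)) : klDiv (p.feedback (π.action p.actionSet t ω))
      (p'.feedback (π.action p.actionSet t ω)) = {ω | π.action p.actionSet t ω = b}.indicator
        (fun _ => klDiv (p.feedback b) (p'.feedback b)) ω := by
    by_cases hb : π.action p.actionSet t ω = b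
    · simp [hb]
    · have hfeed : p.feedback (π.action p.actionSet t ω) = p'.feedback (π.action p.actionSet t ω) :=
        h _ (π.act_mem _ _ _) hb
      simp [hb, hfeed]
  refine (klDiv_historyLaw_le π hp T).trans_eq ?_
  rw [expectedPulls, ENNReal.ofReal_sum_of_nonneg fun _ _ => measureReal_nonneg, Finset.mul_sum]
  refine Finset.sum_congr rfl fun t _ => ?_
  have hmeas : MeasurableSet {ω | π.action p.actionSet t ω = b} :=
    measurable_action π _ t (measurableSet_singleton b)
  simp_rw [hact]
  rw [lintegral_indicator_const hmeas, ofReal_measureReal]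

lemma integral_pullCount (p : Problem d m) (A : Finset (Fin d)) (T : ℕ) :
    ∫ h, pullCount A h.2 ∂historyLaw π p T = expectedPulls π p A T := by
  have hmeas (t : ℕ) : MeasurableSet {ω | π.action p.actionSet t ω = A} :=
    measurable_action π _ t (measurableSet_singleton A)
  have hcount (ω : S × (ℕ → Fin d → ℝ)) : pullCount A (π.history p.actionSet ω T) =
      ∑ t ∈ Finset.range T, {ω | π.action p.actionSet t ω = A}.indicator 1 ω := by
    simp only [pullCount, history_fst, Finset.sum_range, Set.indicator_apply, Set.mem_ofPred_eq,
      Pi.one_apply]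
  rw [historyLaw, integral_map (by fun_prop) (Measurable.aestronglyMeasurable (by fun_prop))]
  simp only [hcount]
  rw [integral_finsetSum _ fun t _ => (integrable_const 1).indicator (hmeas t)]
  simp only [integral_indicator_one (hmeas _), expectedPulls]

lemma integrable_pullCount (A : Finset (Fin d)) {T : ℕ}
    (P : Measure (S × (Fin T → Observation d))) [IsFiniteMeasure P] :
    Integrable (fun h => pullCount A h.2) P :=
  .of_bound (Measurable.aestronglyMeasurable (by fun_prop)) T <| ae_of_all _ fun h => by
    rw [Real.norm_of_nonneg (pullCount_nonneg A h.2)]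
    exact pullCount_le A h.2

lemma measureReal_half_le_pullCount (p : Problem d m) (b : Finset (Fin d)) {T : ℕ} (hT : 0 < T) :
    (historyLaw π p T).real {h | (T : ℝ) / 2 ≤ pullCount b h.2} ≤
      2 * expectedPulls π p b T / T := by
  have hmarkov := mul_meas_ge_le_integral_of_nonneg
    (ae_of_all (historyLaw π p T) fun h => pullCount_nonneg b h.2) (integrable_pullCount b _)
    (T / 2)
  rw [integral_pullCount] at hmarkov
  rw [le_div_iff₀ (by positivity)]
  linarith

lemma measureReal_pullCount_lt_half (p : Problem d m) (b : Finset (Fin d)) {T : ℕ} (hT : 0 < T) :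
    (historyLaw π p T).real {h | pullCount b h.2 < (T : ℝ) / 2} ≤
      2 * (T - expectedPulls π p b T) / T := by
  have hmarkov := mul_meas_ge_le_integral_of_nonneg
    (ae_of_all (historyLaw π p T) fun h => sub_nonneg.2 (pullCount_le b h.2))
    ((integrable_const _).sub (integrable_pullCount b _)) (T / 2)
  rw [integral_sub (integrable_const _) (integrable_pullCount b _), integral_pullCount,
    integral_const, probReal_univ, one_smul] at hmarkov
  have hmono : (historyLaw π p T).real {h | pullCount b h.2 < (T : ℝ) / 2} ≤
      (historyLaw π p T).real {h | (T : ℝ) / 2 ≤ T - pullCount b h.2} :=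
    measureReal_mono fun h (hh : pullCount b h.2 < (T : ℝ) / 2) =>
      show (T : ℝ) / 2 ≤ T - pullCount b h.2 by linarith
  rw [le_div_iff₀ (by positivity)]
  nlinarith

lemma exp_neg_klDiv_mul_expectedPulls_le (hp : p'.actionSet = p.actionSet)
    {b : Finset (Fin d)} (h : ∀ A ∈ p.actionSet.actions, A ≠ b → p.feedback A = p'.feedback A)
    (hb : klDiv (p.feedback b) (p'.feedback b) ≠ ∞) {T : ℕ} (hT : 0 < T) :
    Real.exp (-((klDiv (p.feedback b) (p'.feedback b)).toReal * expectedPulls π p b T) / 2) ≤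
      √(2 * (T - expectedPulls π p' b T) / T) + √(2 * expectedPulls π p b T / T) := by
  have hle := klDiv_historyLaw_le_mul_expectedPulls π hp h T
  have hfin := ENNReal.mul_ne_top hb (ENNReal.ofReal_ne_top (r := expectedPulls π p b T))
  have htoReal : (klDiv (historyLaw π p T) (historyLaw π p' T)).toReal ≤
      (klDiv (p.feedback b) (p'.feedback b)).toReal * expectedPulls π p b T := by
    simpa [ENNReal.toReal_ofReal (expectedPulls_nonneg π p b T)] using ENNReal.toReal_mono hfin hle
  have hset : MeasurableSet
      {h : S × (Fin T → Observation d) | pullCount b h.2 < (T : ℝ) / 2} :=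
    measurableSet_lt (by fun_prop) measurable_const
  calc Real.exp (-((klDiv (p.feedback b) (p'.feedback b)).toReal * expectedPulls π p b T) / 2)
      ≤ Real.exp (-(klDiv (historyLaw π p T) (historyLaw π p' T)).toReal / 2) := by gcongr
    _ ≤ √((historyLaw π p' T).real {h | pullCount b h.2 < (T : ℝ) / 2}) +
          √((historyLaw π p T).real {h | pullCount b h.2 < (T : ℝ) / 2}ᶜ) :=
        exp_neg_half_klDiv_le _ _ (ne_top_of_le_ne_top hfin hle) hset
    _ ≤ _ := by
        gcongr
        · exact measureReal_pullCount_lt_half π p' b hT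
        · simpa only [Set.compl_ofPred, not_lt] using measureReal_half_le_pullCount π p b hT

lemma isLittleO_sqrt_div {f : ℕ → ℝ} {c : ℝ}
    (hf : f =o[atTop] fun T : ℕ => (T : ℝ) ^ (1 - c)) :
    (fun T : ℕ => √(2 * f T / T)) =o[atTop] fun T : ℕ => Real.exp (-(c * Real.log T) / 2) := by
  have hdiv : (fun T : ℕ => 2 * f T / T) =o[atTop] fun T : ℕ => (T : ℝ) ^ (1 - c) / T :=
    (hf.const_mul_left 2).mul_isBigO (Asymptotics.isBigO_refl _ _)
  have hrpow := hdiv.rpow (r := 1 / 2) (by norm_num) (.of_forall fun T => by positivity)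
  refine (hrpow.congr_left fun T => (Real.sqrt_eq_rpow _).symm).congr' .rfl ?_
  filter_upwards [eventually_gt_atTop 0] with T hT
  have hT' : (0 : ℝ) < T := Nat.cast_pos.2 hT
  rw [← Real.rpow_sub_one hT'.ne', ← Real.rpow_mul hT'.le, Real.rpow_def_of_pos hT']
  ring_nf

theorem Algorithm.IsConsistent.eventually_log_le {σ γ : ℝ} {π : Algorithm d m S}
    (hπ : π.IsConsistent σ γ) (hp : p.IsSubgaussianWith σ γ) (hp' : p'.IsSubgaussianWith σ γ)
    (hact : p'.actionSet = p.actionSet) {b : Finset (Fin d)} (hb : b ∈ p.actionSet.actions)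
    (hgap : 0 < p.gap b) (hgap' : ∀ A ∈ p'.actionSet.actions, A ≠ b → 0 < p'.gap A)
    (h : ∀ A ∈ p.actionSet.actions, A ≠ b → p.feedback A = p'.feedback A)
    (hkl : klDiv (p.feedback b) (p'.feedback b) ≠ ∞) {c : ℝ} (hc : c < 1) :
    ∀ᶠ T : ℕ in atTop, c * Real.log T ≤
      (klDiv (p.feedback b) (p'.feedback b)).toReal * expectedPulls π p b T := by
  have hlittle := (isLittleO_sqrt_div (hπ.sub_expectedPulls_isLittleO hp' (hact ▸ hb) hgap'
    (sub_pos.2 hc))).add (isLittleO_sqrt_div (hπ.expectedPulls_isLittleO hp hb hgap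
    (sub_pos.2 hc)))
  filter_upwards [hlittle.eventuallyLE, eventually_gt_atTop 0] with T hT hpos
  have hexp := (exp_neg_klDiv_mul_expectedPulls_le π hact h hkl hpos).trans
    ((le_abs_self _).trans (hT.trans_eq (abs_of_pos (Real.exp_pos _))))
  linarith [Real.exp_le_exp.1 hexp]

end ChangeOfMeasure

end SemiBandit

section BlockCovariance

lemma sum_comp_of_card_fiber {ι B : Type*} [Fintype ι] [Fintype B] [DecidableEq B] {g : ι → B}
    {m : ℕ} (hg : ∀ b, (Finset.univ.filter (g · = b)).card = m) (f : B → ℝ) :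
    ∑ i, f (g i) = m * ∑ b, f b := by
  rw [← Finset.sum_fiberwise' Finset.univ g f, Finset.mul_sum]
  simp only [Finset.sum_const, hg, nsmul_eq_mul]

lemma one_add_mul_sub_one_pos {m : ℕ} {γ : ℝ} (hm : m ≠ 0) (hγ : 0 ≤ γ) :
    (0 : ℝ) < 1 + γ * (m - 1) :=
  add_pos_of_pos_of_nonneg one_pos
    (mul_nonneg hγ (sub_nonneg.2 (by exact_mod_cast Nat.one_le_iff_ne_zero.2 hm)))

variable {ι B : Type*} [DecidableEq ι] [DecidableEq B]

/-- The covariance matrix with variances `σ ^ 2`, with correlation coefficients `γ` between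
indices of the same fiber of `g`, and `0` between indices of different fibers. -/
def blockCovariance (g : ι → B) (σ γ : ℝ) : Matrix ι ι ℝ :=
  σ ^ 2 • (γ • (1 : Matrix B B ℝ).submatrix g g + (1 - γ) • 1)

lemma posSemidef_blockCovariance (g : ι → B) (σ : ℝ) {γ : ℝ} (hγ0 : 0 ≤ γ) (hγ1 : γ ≤ 1) :
    (blockCovariance g σ γ).PosSemidef :=
  (((PosSemidef.one.submatrix g).smul hγ0).add (PosSemidef.one.smul (sub_nonneg.2 hγ1))).smul
    (sq_nonneg σ)

lemma blockCovariance_self (g : ι → B) (σ γ : ℝ) (i : ι) :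
    blockCovariance g σ γ i i = σ ^ 2 := by
  simp [blockCovariance]

lemma blockCovariance_of_ne (g : ι → B) (σ γ : ℝ) {i j : ι} (h : i ≠ j) :
    blockCovariance g σ γ i j = if g i = g j then σ ^ 2 * γ else 0 := by
  simp [blockCovariance, one_apply, h]

variable [Fintype ι] {g : ι → B} {m : ℕ}

lemma blockCovariance_mulVec_comp [Finite B]
    (hg : ∀ b, (Finset.univ.filter (g · = b)).card = m) (σ γ : ℝ) (v : B → ℝ) :
    blockCovariance g σ γ *ᵥ (v ∘ g) = (σ ^ 2 * (1 + γ * (m - 1))) • (v ∘ g) := by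
  have := Fintype.ofFinite B
  have hblock : (1 : Matrix B B ℝ).submatrix g g *ᵥ (v ∘ g) = (m : ℝ) • (v ∘ g) := by
    ext i
    have := sum_comp_of_card_fiber hg fun b => (1 : Matrix B B ℝ) (g i) b * v b
    simpa [mulVec, dotProduct, one_apply] using this
  rw [blockCovariance, smul_mulVec, add_mulVec, smul_mulVec, smul_mulVec, hblock, one_mulVec,
    smul_smul, ← add_smul, smul_smul]
  ring_nf

lemma klDiv_gaussianPi_blockCovariance [Fintype B]
    (hg : ∀ b, (Finset.univ.filter (g · = b)).card = m) {σ γ : ℝ} (hγ0 : 0 ≤ γ) (hγ1 : γ ≤ 1)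
    (h : σ ^ 2 * (1 + γ * (m - 1)) ≠ 0) (ν v : B → ℝ) :
    klDiv (gaussianPi (ν ∘ g) (blockCovariance g σ γ))
        (gaussianPi ((ν + v) ∘ g) (blockCovariance g σ γ)) =
      ENNReal.ofReal (m * (v ⬝ᵥ v) / (2 * (σ ^ 2 * (1 + γ * (m - 1))))) := by
  set l := σ ^ 2 * (1 + γ * (m - 1)) with hl
  have hmean : (ν + v) ∘ g = ν ∘ g + blockCovariance g σ γ *ᵥ ((l⁻¹ • v) ∘ g) := by
    rw [blockCovariance_mulVec_comp hg]
    ext i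
    simp [← hl, h]
  have hdot : ((l⁻¹ • v) ∘ g) ⬝ᵥ ((l⁻¹ • v) ∘ g) = m * ((l⁻¹ • v) ⬝ᵥ (l⁻¹ • v)) :=
    sum_comp_of_card_fiber hg fun b => (l⁻¹ • v) b * (l⁻¹ • v) b
  rw [hmean, klDiv_gaussianPi _ _ (posSemidef_blockCovariance g σ hγ0 hγ1),
    blockCovariance_mulVec_comp hg, ← hl, dotProduct_smul, hdot, smul_dotProduct, dotProduct_smul]
  congr 1
  simp only [smul_eq_mul]
  field_simp

end BlockCovariance

lemma single_le_single_self {ι α : Type*} [DecidableEq ι] [Zero α] [Preorder α] (i : ι) {x : α}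
    (hx : 0 ≤ x) (j : ι) : (Pi.single i x : ι → α) j ≤ (Pi.single i x : ι → α) i := by
  obtain rfl | h := eq_or_ne j i
  · rfl
  · simpa [h] using hx

lemma coe_le_liminf_div {α : Type*} {l : Filter α} {f g : α → ℝ} {K : ℝ}
    (hg : ∀ᶠ t in l, 0 < g t) (h : ∀ x < K, ∀ᶠ t in l, x * g t ≤ f t) :
    (K : EReal) ≤ liminf (fun t => ((f t / g t : ℝ) : EReal)) l := by
  refine le_of_tendsto (x := 𝓝[<] K) continuous_coe_real_ereal.continuousWithinAt ?_
  filter_upwards [self_mem_nhdsWithin] with x hx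
  refine le_liminf_of_le (by isBoundedDefault) ?_
  filter_upwards [hg, h x hx] with t htg ht
  exact EReal.coe_le_coe_iff.2 ((le_div_iff₀ htg).2 ht)

lemma card_filter_finProdFinEquiv_symm_snd {m k : ℕ} (b : Fin k) :
    (Finset.univ.filter fun i : Fin (m * k) => (finProdFinEquiv.symm i).2 = b).card = m := by
  have h : (Finset.univ.filter fun i : Fin (m * k) => (finProdFinEquiv.symm i).2 = b) =
      Finset.univ.map ((Function.Embedding.sectL (Fin m) b).trans finProdFinEquiv.toEmbedding) := by
    ext i
    obtain ⟨⟨r, c⟩, rfl⟩ := finProdFinEquiv.surjective i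
    simp only [Finset.mem_filter, Finset.mem_univ, true_and, Equiv.symm_apply_apply]
    simp [eq_comm, -finProdFinEquiv_apply_val]
  rw [h, Finset.card_map, Finset.card_univ, Fintype.card_fin]

namespace SemiBandit

section BlockProblem

variable {d m : ℕ} {B : Type*} [DecidableEq B]

/-- The arms of the block `b`, when `g` maps each arm to its block. -/
def block (g : Fin d → B) (b : B) : Finset (Fin d) :=
  Finset.univ.filter (g · = b)

lemma surjective_of_card_block {g : Fin d → B} (hg : ∀ b, (block g b).card = m) (hm : m ≠ 0) :
    Function.Surjective g := by
  intro b
  obtain ⟨i, hi⟩ := Finset.card_ne_zero.1 ((hg b).trans_ne hm)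
  exact ⟨i, (Finset.mem_filter.1 hi).2⟩

lemma block_injective {g : Fin d → B} (hg : Function.Surjective g) :
    Function.Injective (block g) := by
  intro b c h
  obtain ⟨i, rfl⟩ := hg b
  have hi : i ∈ block g c := h ▸ Finset.mem_filter.2 ⟨Finset.mem_univ i, rfl⟩
  exact (Finset.mem_filter.1 hi).2

variable [Fintype B] [Nonempty B]

/-- The problem whose actions are the blocks, with Gaussian rewards of mean `ν b` for the arms of
the block `b`, of variance `σ ^ 2`, and of correlation coefficient `γ` inside the blocks. -/
noncomputable def blockProblem (g : Fin d → B) (hg : ∀ b, (block g b).card = m) (σ γ : ℝ)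
    (ν : B → ℝ) : Problem d m where
  actionSet :=
    { actions := Finset.univ.image (block g)
      nonempty := Finset.univ_nonempty.image _
      card_eq := by simpa using hg }
  law := gaussianPi (ν ∘ g) (blockCovariance g σ γ)
  isProb := inferInstance

variable {g : Fin d → B} (hg : ∀ b, (block g b).card = m) (σ γ : ℝ) (ν : B → ℝ)

lemma mem_blockProblem_actions {A : Finset (Fin d)} :
    A ∈ (blockProblem g hg σ γ ν).actionSet.actions ↔ ∃ b, block g b = A := by
  simp [blockProblem]

lemma mean_blockProblem : (blockProblem g hg σ γ ν).mean = ν ∘ g := by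
  ext i
  rw [← integral_id_gaussianPi (ν ∘ g) (blockCovariance g σ γ)]
  have hint (i : Fin d) :
      Integrable (fun x : Fin d → ℝ => x i) (gaussianPi (ν ∘ g) (blockCovariance g σ γ)) :=
    IsGaussian.integrable_dual _ (ContinuousLinearMap.proj (R := ℝ) (φ := fun _ : Fin d => ℝ) i)
  exact (eval_integral hint i).symm

lemma value_block (b : B) : (blockProblem g hg σ γ ν).value (block g b) = m * ν b := by
  have hconst (i : Fin d) (hi : i ∈ block g b) : (ν ∘ g) i = ν b :=
    congrArg ν (Finset.mem_filter.1 hi).2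
  rw [Problem.value, mean_blockProblem, Finset.sum_congr rfl hconst, Finset.sum_const, hg,
    nsmul_eq_mul]

lemma gap_block {c : B} (hc : ∀ b, ν b ≤ ν c) (b : B) :
    (blockProblem g hg σ γ ν).gap (block g b) = m * (ν c - ν b) := by
  have hmem (b : B) : block g b ∈ (blockProblem g hg σ γ ν).actionSet.actions :=
    (mem_blockProblem_actions hg σ γ ν).2 ⟨b, rfl⟩
  have hsup : (blockProblem g hg σ γ ν).actionSet.actions.sup'
      (blockProblem g hg σ γ ν).actionSet.nonempty (blockProblem g hg σ γ ν).value = m * ν c := by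
    refine le_antisymm (Finset.sup'_le _ _ fun A hA => ?_) ?_
    · obtain ⟨b, rfl⟩ := (mem_blockProblem_actions hg σ γ ν).1 hA
      rw [value_block]
      exact mul_le_mul_of_nonneg_left (hc b) (Nat.cast_nonneg m)
    · rw [← value_block hg σ γ ν c]
      exact Finset.le_sup' _ (hmem c)
  rw [Problem.gap, hsup, value_block, mul_sub]

variable {σ γ}

lemma isSubgaussianWith_blockProblem (hγ0 : 0 ≤ γ) (hγ1 : γ ≤ 1) :
    (blockProblem g hg σ γ ν).IsSubgaussianWith σ γ := by
  have hC := posSemidef_blockCovariance g σ hγ0 hγ1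
  refine ⟨blockCovariance g σ γ, ⟨hC, fun u => ?_⟩, fun i => (blockCovariance_self g σ γ i).le,
    fun i j hij => ?_⟩
  · rw [mean_blockProblem]
    exact ⟨integrable_exp_dotProduct_gaussianPi _ _ _,
      (integral_exp_dotProduct_gaussianPi _ u hC).le⟩
  · rw [blockCovariance_self, blockCovariance_self, blockCovariance_of_ne g σ γ hij,
      Real.sqrt_mul_self (sq_nonneg σ)]
    split_ifs
    · exact div_le_of_le_mul₀ (sq_nonneg σ) hγ0 (mul_comm γ _).ge
    · simpa using hγ0

lemma feedback_block_add {v : B → ℝ} {b : B} (hb : v b = 0) :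
    (blockProblem g hg σ γ (ν + v)).feedback (block g b) =
      (blockProblem g hg σ γ ν).feedback (block g b) := by
  have hlaw : (blockProblem g hg σ γ (ν + v)).law =
      (blockProblem g hg σ γ ν).law.map (· + v ∘ g) :=
    (map_add_gaussianPi (ν ∘ g) (v ∘ g) _).symm
  have hobserve : observe (block g b) ∘ (· + v ∘ g) = observe (block g b) := by
    ext x i
    · rfl
    · by_cases hi : g i = b <;> simp [observe, block, hi, hb]
  rw [Problem.feedback_apply, hlaw, Measure.map_map (by fun_prop) (by fun_prop), hobserve]
  rfl

variable {S : Type*} [MeasurableSpace S] {π : Algorithm d m S}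

lemma klDiv_feedback_blockProblem_le (hγ0 : 0 ≤ γ) (hγ1 : γ ≤ 1)
    (h : σ ^ 2 * (1 + γ * (m - 1)) ≠ 0) (v : B → ℝ) (A : Finset (Fin d)) :
    klDiv ((blockProblem g hg σ γ ν).feedback A) ((blockProblem g hg σ γ (ν + v)).feedback A) ≤
      ENNReal.ofReal (m * (v ⬝ᵥ v) / (2 * (σ ^ 2 * (1 + γ * (m - 1))))) := by
  rw [← klDiv_gaussianPi_blockCovariance hg hγ0 hγ1 h ν v]
  exact klDiv_map_le _ _ (by fun_prop)

lemma Algorithm.IsConsistent.eventually_log_le_expectedPulls_block (hπ : π.IsConsistent σ γ)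
    (hm : m ≠ 0) (hσ : σ ≠ 0) (hγ0 : 0 ≤ γ) (hγ1 : γ ≤ 1) {b c : B} (hc : ∀ b', ν b' ≤ ν c)
    (hb : ν b < ν c) {s a : ℝ} (hs : ν c < ν b + s) (ha : a < 1) :
    ∀ᶠ T : ℕ in atTop, a * Real.log T ≤ m * s ^ 2 / (2 * (σ ^ 2 * (1 + γ * (m - 1)))) *
      expectedPulls π (blockProblem g hg σ γ ν) (block g b) T := by
  have hm0 : (0 : ℝ) < m := by positivity
  have hl : 0 < σ ^ 2 * (1 + γ * (m - 1)) :=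
    mul_pos (by positivity) (one_add_mul_sub_one_pos hm hγ0)
  have hbest (b' : B) : (ν + Pi.single b s : B → ℝ) b' ≤ (ν + Pi.single b s : B → ℝ) b := by
    obtain rfl | h := eq_or_ne b' b
    · rfl
    · simpa [h] using (hc b').trans hs.le
  have hkl := klDiv_feedback_blockProblem_le hg ν hγ0 hγ1 hl.ne' (Pi.single b s) (block g b)
  rw [single_dotProduct, Pi.single_eq_same, ← sq] at hkl
  have hlog := hπ.eventually_log_le (isSubgaussianWith_blockProblem hg ν hγ0 hγ1)
    (isSubgaussianWith_blockProblem hg (ν + Pi.single b s) hγ0 hγ1) rfl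
    ((mem_blockProblem_actions hg σ γ ν).2 ⟨b, rfl⟩)
    (by rw [gap_block hg σ γ ν hc]; exact mul_pos hm0 (sub_pos.2 hb)) ?_ ?_
    (hkl.trans_lt ENNReal.ofReal_lt_top).ne ha
  · filter_upwards [hlog] with T hT
    exact hT.trans (mul_le_mul_of_nonneg_right
      (ENNReal.toReal_le_of_le_ofReal (by positivity) hkl) (expectedPulls_nonneg _ _ _ _))
  all_goals
    rintro A hA hAb
    obtain ⟨b', rfl⟩ := (mem_blockProblem_actions hg σ γ _).1 hA
    have hne : b' ≠ b := fun h => hAb (h ▸ rfl)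
  · rw [gap_block hg σ γ _ hbest]
    refine mul_pos hm0 (sub_pos.2 ?_)
    simpa [hne] using (hc b').trans_lt hs
  · exact (feedback_block_add hg ν (Pi.single_eq_of_ne hne s)).symm

lemma expectedRegret_blockProblem (hm : m ≠ 0) (T : ℕ) :
    expectedRegret π (blockProblem g hg σ γ ν) T =
      ∑ b, (blockProblem g hg σ γ ν).gap (block g b) *
        expectedPulls π (blockProblem g hg σ γ ν) (block g b) T := by
  rw [expectedRegret_eq_sum]
  exact Finset.sum_image (block_injective (surjective_of_card_block hg hm)).injOn

lemma gap_block_single (hm : m ≠ 0) (c : B) {Δ : ℝ} (hΔ : 0 ≤ Δ) (b : B) :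
    (blockProblem g hg σ γ (Pi.single c (Δ / m))).gap (block g b) = if b = c then 0 else Δ := by
  rw [gap_block hg σ γ _ (single_le_single_self c (by positivity)), Pi.single_eq_same]
  split_ifs with h
  · simp [h]
  · rw [Pi.single_eq_of_ne h]
    rw [sub_zero, mul_div_cancel₀ _ (Nat.cast_ne_zero.2 hm)]

lemma expectedRegret_blockProblem_single (hm : m ≠ 0) (c : B) {Δ : ℝ} (hΔ : 0 ≤ Δ) (T : ℕ) :
    expectedRegret π (blockProblem g hg σ γ (Pi.single c (Δ / m))) T =
      Δ * ∑ b ∈ Finset.univ.erase c,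
        expectedPulls π (blockProblem g hg σ γ (Pi.single c (Δ / m))) (block g b) T := by
  rw [expectedRegret_blockProblem hg _ hm, ← Finset.add_sum_erase _ _ (Finset.mem_univ c),
    gap_block_single hg hm c hΔ, if_pos rfl, zero_mul, zero_add, Finset.mul_sum]
  refine Finset.sum_congr rfl fun b hb => ?_
  rw [gap_block_single hg hm c hΔ, if_neg (Finset.ne_of_mem_erase hb)]

lemma Algorithm.IsConsistent.eventually_log_le_expectedPulls_block_single
    (hπ : π.IsConsistent σ γ) (hm : m ≠ 0) (hσ : σ ≠ 0) (hγ0 : 0 ≤ γ) (hγ1 : γ ≤ 1) {Δ : ℝ}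
    (hΔ : 0 < Δ) {b c : B} (hb : b ≠ c) {r : ℝ} (hr : 1 < r) :
    ∀ᶠ T : ℕ in atTop, r⁻¹ * Real.log T ≤
      m * (r * (Δ / m)) ^ 2 / (2 * (σ ^ 2 * (1 + γ * (m - 1)))) *
        expectedPulls π (blockProblem g hg σ γ (Pi.single c (Δ / m))) (block g b) T := by
  have hΔm : 0 < Δ / m := by positivity
  refine hπ.eventually_log_le_expectedPulls_block hg _ hm hσ hγ0 hγ1
    (single_le_single_self c hΔm.le) ?_ ?_ (inv_lt_one_of_one_lt₀ hr)
  · simpa [hb] using hΔm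
  · simpa [hb] using lt_mul_of_one_lt_left hΔm hr

theorem Algorithm.IsConsistent.le_liminf_expectedRegret_blockProblem (hπ : π.IsConsistent σ γ)
    (hm : m ≠ 0) (hσ : σ ≠ 0) (hγ0 : 0 ≤ γ) (hγ1 : γ ≤ 1) (c : B) {Δ : ℝ} (hΔ : 0 < Δ) :
    (((1 + γ * (m - 1)) * (2 * σ ^ 2 * (d - m) / Δ) : ℝ) : EReal) ≤
      liminf (fun T : ℕ => ((expectedRegret π (blockProblem g hg σ γ (Pi.single c (Δ / m))) T /
        Real.log T : ℝ) : EReal)) atTop := by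
  set K : ℝ := (1 + γ * (m - 1)) * (2 * σ ^ 2 * (d - m) / Δ) with hK
  set p := blockProblem g hg σ γ (Pi.single c (Δ / m))
  have hlog : ∀ᶠ T : ℕ in atTop, 0 < Real.log T :=
    (Real.tendsto_log_atTop.comp tendsto_natCast_atTop_atTop).eventually_gt_atTop 0
  refine coe_le_liminf_div hlog fun x hx => ?_
  have hr : Tendsto (fun r => K / r ^ 3) (𝓝[>] 1) (𝓝 K) := by
    have h : ContinuousAt (fun r : ℝ => K / r ^ 3) 1 := by fun_prop (disch := norm_num)
    simpa using h.tendsto.mono_left nhdsWithin_le_nhds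
  obtain ⟨r, hxr, hr1 : 1 < r⟩ :=
    ((hr.eventually_const_lt hx).and self_mem_nhdsWithin).exists
  have hκ := one_add_mul_sub_one_pos hm hγ0
  have hd : (d : ℝ) = m * Fintype.card B := by simpa using sum_comp_of_card_fiber hg fun _ => 1
  set Q : ℝ := m * (r * (Δ / m)) ^ 2 / (2 * (σ ^ 2 * (1 + γ * (m - 1)))) with hQ
  have hpulls (b : B) (hb : b ∈ Finset.univ.erase c) : ∀ᶠ T : ℕ in atTop,
      r⁻¹ * Real.log T ≤ Q * expectedPulls π p (block g b) T :=
    hπ.eventually_log_le_expectedPulls_block_single hg hm hσ hγ0 hγ1 hΔ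
      (Finset.ne_of_mem_erase hb) hr1
  filter_upwards [hlog, (Finset.eventually_all _).2 hpulls] with T hT hpulls
  have : 0 < r := one_pos.trans hr1
  calc x * Real.log T ≤ K / r ^ 3 * Real.log T := by gcongr
    _ = Δ * ∑ _ ∈ Finset.univ.erase c, r⁻¹ * Real.log T / Q := by
      rw [Finset.sum_const, Finset.card_erase_of_mem (Finset.mem_univ c), Finset.card_univ,
        nsmul_eq_mul, Nat.cast_pred Fintype.card_pos, hQ, hK, hd]
      field_simp
    _ ≤ Δ * ∑ b ∈ Finset.univ.erase c, expectedPulls π p (block g b) T := by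
      gcongr with _ hb
      exact (div_le_iff₀' (by positivity)).2 (hpulls _ hb)
    _ = expectedRegret π p T := (expectedRegret_blockProblem_single hg hm c hΔ.le T).symm

end BlockProblem

end SemiBandit

theorem theorem1 {S : Type*} [MeasurableSpace S] (d m : ℕ) (hm : 1 ≤ m) (hmd : m ≤ d)
    (hdvd : m ∣ d) (σ γ Δ : ℝ) (hσ : 0 < σ) (hγ0 : 0 ≤ γ) (hγ1 : γ ≤ 1) (hΔ : 0 < Δ)
    (π : SemiBandit.Algorithm d m S) (hπ : π.IsConsistent σ γ) :
    ∃ p : SemiBandit.Problem d m,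
      (∀ A ∈ p.actionSet.actions, p.gap A = 0 ∨ p.gap A = Δ) ∧
      p.IsSubgaussianWith σ γ ∧
      (((1 + γ * ((m : ℝ) - 1)) * (2 * σ ^ 2 * ((d : ℝ) - (m : ℝ)) / Δ) : ℝ) : EReal) ≤
        liminf (fun t : ℕ => ((SemiBandit.expectedRegret π p t / Real.log (t : ℝ) : ℝ) : EReal))
          atTop := by
  obtain ⟨k, rfl⟩ := hdvd
  have hm0 : m ≠ 0 := Nat.one_le_iff_ne_zero.1 hm
  have : NeZero k := ⟨by rintro rfl; omega⟩
  have hg (b : Fin k) : (SemiBandit.block (fun i => (finProdFinEquiv.symm i).2) b).card = m :=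
    card_filter_finProdFinEquiv_symm_snd b
  refine ⟨SemiBandit.blockProblem _ hg σ γ (Pi.single 0 (Δ / m)), fun A hA => ?_,
    SemiBandit.isSubgaussianWith_blockProblem hg _ hγ0 hγ1, ?_⟩
  · obtain ⟨b, rfl⟩ := (SemiBandit.mem_blockProblem_actions hg σ γ _).1 hA
    rw [SemiBandit.gap_block_single hg hm0 0 hΔ.le]
    exact ite_eq_or_eq _ _ _
  · exact hπ.le_liminf_expectedRegret_blockProblem hg hm0 hσ.ne' hγ0 hγ1 0 hΔ
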